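/- **Theorem (existence of weak potential type evolutions).** Let $\mathcal E$ and $\mathcal F$ be Euclidean spaces (finite-dimensional real inner product spaces, identified with their duals) with $\dim\mathcal F<\dim\mathcal E$, let $J:\mathcal E\to[0,\infty)$, let $A:\mathcal E\to\mathcal F$ be linear with adjoint $A^*$, let $T>0$ and $f:[0,T]\to\mathcal F$. *Notation.* For $S:\mathcal E\to[0,\infty)$ the Fréchet subdifferential $\partial S(u)$ is the set of all $\xi\in\mathcal E$ with $$\liminf_{v\to u}\frac{S(v)-S(u)-\langle\xi,v-u\rangle}{|v-u|}\ge 0 .$$ A point $u$ is a critical point of $S$ on $\mathbf A(c):=\{v: Av=c\}$ if $Au=c$ and $\partial S(u)\cap\operatorname{ran}(A^*)\neq\emptyset$. For $\eta>0$ and $\bar v\in\mathcal E$ put $J_{\eta,\bar v}(v):=J(v)+\eta|v-\bar v|^2$. A *discrete quasistatic evolution* with time step $\delta>0$, initial condition $v_0$ and constraint $f$ is a right-continuous function $v_\delta:[-\delta,T]\to\mathcal E$ such that $v_\delta=v_0$ on $[-\delta,\delta)\cap[-\delta,T]$ and such that, for every integer $i\ge0$ with $i\delta\le T$, $v_\delta$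 is constant on $[0,T]\cap[i\delta,(i+1)\delta)$ and $v_\delta(i\delta)$ is a critical point of $J$ on $\mathbf A(f(i\delta))$. A bounded measurable function $v:[0,T]\to\mathcal E$ is an *approximable quasistatic evolution* with initial condition $v_0$ and constraint $f$ if there are a sequence $\delta_k\to0^+$ and discrete quasistatic evolutions $v_{\delta_k}$ with time step $\delta_k$, initial condition $v_0$ and constraint $f$, such that $\liminf_{k\to\infty}|v_{\delta_k}(t)-v(t)|=0$ for every $t\in[0,T]$. *Assumptions.* Suppose that - $(\gamma)$ there is $\gamma>0$ with $|A^*q|\ge\gamma|q|$ for every $q\in\mathcal F$; - (J1) $J(v)+|Av|^2\to\infty$ as $|v|\to\infty$; - (J2) $\eta>0$ is such that $v\mapsto J(v)+\eta|v|^2$ is strongly convex, i.e. for some $\mu>0$ the function $v\mapsto J(v)+\eta|v|^2-\frac{\mu}{2}|v|^2$ is convex; - (J3) there is $L>0$ such that $\xi\in\partial J(v)$ implies $|\xi|\le L(J(v)+1)$, for every $v\in\mathcal E$; - (J4) for the same $\eta$ there is $C>0$ such that, for all $\bar v,v_1,v_2\in\mathcal E$ and $q_1,q_2\in\mathcal F$,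 if $A^*q_i\in\partial J_{\eta,\bar v}(v_i)$ for $i=1,2$, then $$\langle q_1-q_2,Av_1-Av_2\rangle\le C\,|v_1-v_2|\,|Av_1-Av_2| ;$$ - $f\in W^{1,2}([0,T];\mathcal F)$ (continuous representative), with weak derivative $\dot f$, and $v_0$ is a critical point of $J$ on $\mathbf A(f(0))$. *Conclusion.* There exist bounded measurable functions $v:[0,T]\to\mathcal E$ and $q:[0,T]\to\mathcal F$ such that - (a) $v$ is an approximable quasistatic evolution with initial condition $v_0$ and constraint $f$; - (b) $A^*q(t)\in\partial J(v(t))$ for every $t\in[0,T]$; - (c) the function $s\mapsto\langle q(s),\dot f(s)\rangle$ belongs to $L^1(0,T)$ and, for every $t\in[0,T]$, $$J(v(t))\le J(v_0)+\int_0^t\langle q(s),\dot f(s)\rangle\,ds .$$ -/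

import Mathlib

open Set Filter Topology MeasureTheory
open scoped ContDiff

section Basic

variable {E F : Type*} [NormedAddCommGroup E] [InnerProductSpace ℝ E] [FiniteDimensional ℝ E]
  [NormedAddCommGroup F] [InnerProductSpace ℝ F] [FiniteDimensional ℝ F]

/-- The Fréchet subdifferential of `S` at `u`, with the dual of the Euclidean space identified
with the space itself: `ξ` belongs to it iff
`liminf_{v → u} (S v - S u - ⟪ξ, v - u⟫) / |v - u| ≥ 0`, the lower limit being spelled out
with `ε` (at `v = u` the inequality below is trivial). -/
def frechetSubdifferential (S : E → ℝ) (u : E) : Set E :=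
  {ξ | ∀ ε : ℝ, 0 < ε → ∀ᶠ v in 𝓝 u, -(ε * ‖v - u‖) ≤ S v - (S u + inner ℝ ξ (v - u))}

/-- `u` is a critical point of `S` on the affine space `{v | A v = c}`. -/
def IsConstrainedCriticalPoint (A : E →ₗ[ℝ] F) (S : E → ℝ) (c : F) (u : E) : Prop :=
  A u = c ∧ (frechetSubdifferential S u ∩ Set.range (LinearMap.adjoint A)).Nonempty

/-- The functional `J_{η, w}`, that is `v ↦ J v + η |v - w|²`. -/
def quadPerturbation (J : E → ℝ) (η : ℝ) (w : E) : E → ℝ :=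
  fun v => J v + η * ‖v - w‖ ^ 2

/-- `f` belongs to `W^{1,2}([0,T]; F)` and `f'` is its weak derivative. As usual in
dimension one, `f` is the continuous representative; values outside `[0,T]` are irrelevant. -/
structure HasW12Deriv (T : ℝ) (f f' : ℝ → F) : Prop where
  continuousOn : ContinuousOn f (Icc 0 T)
  memLp : MemLp f 2 (volume.restrict (Ioo 0 T))
  memLp_deriv : MemLp f' 2 (volume.restrict (Ioo 0 T))
  integral_eq : ∀ φ : ℝ → ℝ, ContDiff ℝ ∞ φ → HasCompactSupport φ → tsupport φ ⊆ Ioo 0 T →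
    ∫ t in Ioo 0 T, deriv φ t • f t = -∫ t in Ioo 0 T, φ t • f' t

/-- Discrete quasistatic evolution `[-δ, T] → E` in the nondissipative case, with time step `δ`,
initial condition `v₀` and constraint `f`. Values of `w` outside `[-δ, T]` are irrelevant. -/
structure IsDiscreteEvolution (A : E →ₗ[ℝ] F) (J : E → ℝ) (f : ℝ → F) (T : ℝ) (v₀ : E)
    (δ : ℝ) (w : ℝ → E) : Prop where
  right_continuous : ∀ t ∈ Icc (-δ) T, ContinuousWithinAt w (Icc (-δ) T ∩ Ici t) t
  eq_initial : ∀ t ∈ Icc (-δ) T, t < δ → w t = v₀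
  piecewise_constant : ∀ i : ℕ, (i : ℝ) * δ ≤ T →
    ∀ t ∈ Icc 0 T ∩ Ico ((i : ℝ) * δ) (((i : ℝ) + 1) * δ), w t = w ((i : ℝ) * δ)
  critical : ∀ i : ℕ, (i : ℝ) * δ ≤ T →
    IsConstrainedCriticalPoint A J (f ((i : ℝ) * δ)) (w ((i : ℝ) * δ))

/-- A bounded measurable function `[0, T] → X`; values outside `[0, T]` are irrelevant. -/
def IsBoundedMeasurableOn {X : Type*} [NormedAddCommGroup X] [MeasurableSpace X]
    (T : ℝ) (v : ℝ → X) : Prop :=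
  Measurable (fun t : Icc (0 : ℝ) T => v t) ∧ Bornology.IsBounded (v '' Icc 0 T)

/-- Approximable quasistatic evolution `[0, T] → E` in the nondissipative case, with initial
condition `v₀` and constraint `f`. One sequence of discrete evolutions serves all times `t`.
The lower limit is taken in `[0, ∞]`. -/
def IsApproximableEvolution [MeasurableSpace E] (A : E →ₗ[ℝ] F) (J : E → ℝ) (f : ℝ → F)
    (T : ℝ) (v₀ : E) (v : ℝ → E) : Prop :=
  IsBoundedMeasurableOn T v ∧
  ∃ (δ : ℕ → ℝ) (w : ℕ → ℝ → E),
    (∀ k, 0 < δ k) ∧ Tendsto δ atTop (𝓝 0) ∧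
    (∀ k, IsDiscreteEvolution A J f T v₀ (δ k) (w k)) ∧
    ∀ t ∈ Icc 0 T, liminf (fun k => ‖w k t - v t‖ₑ) atTop = 0

end Basic

/-! Everything rests on a one-step estimate. Let w be critical with multiplier p, and let u minimize
J on the next constraint A v = c. As competitor take the minimizer v₁, on the same constraint, of
the convex function J + η|· - w|², with multiplier q₁. Its subgradient inequality tested at w reads
J(v₁) + η|v₁ - w|² ≤ J(w) + ⟨q₁, c - Aw⟩. By (J4), q₁ may be replaced by p at the price C|v₁ - w||c
- Aw|, which the term η|v₁ - w|² absorbs up to C²/(4η)|c - Aw|². A step thus costs the work of p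
plus an error quadratic in the increment of the constraint
(`exists_le_of_mem_frechetSubdifferential`).

By (γ) and (J3) multipliers are controlled by the energy, so a discrete Grönwall argument bounds
energies and multipliers uniformly in the time step; (J1) then bounds the states. The quadratic
errors add up to a vanishing term, because ∫|ḟ| over a cell is uniformly small
(`exists_discreteEvolution`).

There is no compactness in time, so the convergent subsequence depends on t. It is chosen
measurably: first the power ⟨p_k(t), ḟ(t)⟩ tends to its upper limit, then states and multipliers
converge. The limit power is therefore the upper limit of the whole sequence, and reverse Fatou
yields the energy inequality at every t. Criticality survives because the subdifferential has closed
graph. -/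

/-! ### Subdifferentials, multipliers and the one-step energy estimate -/

section Convex

variable {E F : Type*} [NormedAddCommGroup E] [InnerProductSpace ℝ E] [FiniteDimensional ℝ E]
  [NormedAddCommGroup F] [InnerProductSpace ℝ F] [FiniteDimensional ℝ F]

omit [FiniteDimensional ℝ E] in
theorem mem_frechetSubdifferential_of_le {S : E → ℝ} {u ξ : E}
    (h : ∀ v, S u + inner ℝ ξ (v - u) ≤ S v) : ξ ∈ frechetSubdifferential S u := by
  intro ε hε
  refine Eventually.of_forall fun v => ?_
  have := mul_nonneg hε.le (norm_nonneg (v - u))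
  linarith [h v]

omit [FiniteDimensional ℝ E] in
/-- For a convex function the Fréchet subgradient inequality is global. -/
theorem ConvexOn.le_of_mem_frechetSubdifferential {S : E → ℝ} (hS : ConvexOn ℝ univ S) {u ξ : E}
    (hξ : ξ ∈ frechetSubdifferential S u) (v : E) : S u + inner ℝ ξ (v - u) ≤ S v := by
  refine le_of_forall_pos_le_add fun ε hε => ?_
  obtain ⟨ε', hε', hlt⟩ : ∃ ε' : ℝ, 0 < ε' ∧ ε' * ‖v - u‖ ≤ ε :=
    ⟨ε / (‖v - u‖ + 1), by positivity, by
      rw [div_mul_eq_mul_div, div_le_iff₀ (by positivity)]; nlinarith [norm_nonneg (v - u)]⟩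
  -- The local inequality is used at a point of the segment close to u; convexity carries it to v
  -- after division by s.
  have hlim : Tendsto (fun s : ℝ => u + s • (v - u)) (𝓝[>] 0) (𝓝 u) := by
    have : Continuous fun s : ℝ => u + s • (v - u) := by fun_prop
    simpa using (this.tendsto 0).mono_left nhdsWithin_le_nhds
  have hev := hlim.eventually (hξ ε' hε')
  have h1 : ∀ᶠ s : ℝ in 𝓝[>] 0, s < 1 :=
    nhdsWithin_le_nhds (Iio_mem_nhds (by norm_num))
  obtain ⟨s, hs, hs1, hs0⟩ := (hev.and (h1.and self_mem_nhdsWithin)).exists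
  have hs0 : (0 : ℝ) < s := hs0
  have hc := hS.2 (mem_univ u) (mem_univ v) (by linarith : (0 : ℝ) ≤ 1 - s) hs0.le (by ring)
  have he : (1 - s) • u + s • v = u + s • (v - u) := by module
  rw [he] at hc
  simp only [smul_eq_mul] at hc
  rw [add_sub_cancel_left, norm_smul, inner_smul_right, Real.norm_of_nonneg hs0.le] at hs
  have : s * (S u + inner ℝ ξ (v - u)) ≤ s * (S v + ε) := by
    have := mul_le_mul_of_nonneg_left hlt hs0.le
    nlinarith
  exact le_of_mul_le_mul_left this hs0

omit [FiniteDimensional ℝ E] in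
-- The added term is o(|v - u|) at its own centre.
theorem frechetSubdifferential_quadPerturbation_self (J : E → ℝ) {η : ℝ} (hη : 0 < η) (u : E) :
    frechetSubdifferential (quadPerturbation J η u) u = frechetSubdifferential J u := by
  ext ξ
  simp only [frechetSubdifferential, quadPerturbation, mem_ofPred_eq, sub_self, norm_zero]
  constructor
  · intro h ε hε
    have hb : ∀ᶠ v in 𝓝 u, ‖v - u‖ < ε / 2 / η := by
      have : Tendsto (fun v => ‖v - u‖) (𝓝 u) (𝓝 0) := by
        have : Continuous fun v => ‖v - u‖ := by fun_prop
        simpa using this.tendsto u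
      exact this.eventually (Iio_mem_nhds (by positivity))
    filter_upwards [h (ε / 2) (by positivity), hb] with v hv hv'
    rw [lt_div_iff₀ hη] at hv'
    nlinarith [norm_nonneg (v - u), mul_le_mul_of_nonneg_right hv'.le (norm_nonneg (v - u))]
  · intro h ε hε
    filter_upwards [h ε hε] with v hv
    have : 0 ≤ η * ‖v - u‖ ^ 2 := by positivity
    linarith

omit [FiniteDimensional ℝ E] in
-- Moving the centre of the square changes the function by an affine term only.
theorem convexOn_quadPerturbation {J : E → ℝ} {η : ℝ}
    (h : ConvexOn ℝ univ fun v => J v + η * ‖v‖ ^ 2) (w : E) :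
    ConvexOn ℝ univ (quadPerturbation J η w) := by
  have h2 : ConvexOn ℝ univ fun v : E => -2 * η * inner ℝ w v + η * ‖w‖ ^ 2 := by
    refine ⟨convex_univ, fun x _ y _ a b _ _ hab => le_of_eq ?_⟩
    simp only [inner_add_right, inner_smul_right, smul_eq_mul]
    linear_combination (- η * ‖w‖ ^ 2) * hab
  refine (h.add h2).congr fun v _ => ?_
  simp only [quadPerturbation, Pi.add_apply]
  rw [norm_sub_sq_real, real_inner_comm]
  ring

theorem continuous_of_convexOn_add_sq {J : E → ℝ} {η : ℝ}
    (h : ConvexOn ℝ univ fun v => J v + η * ‖v‖ ^ 2) : Continuous J := by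
  have h1 : Continuous fun v => J v + η * ‖v‖ ^ 2 := h.locallyLipschitz.continuous
  have h2 : Continuous fun v : E => η * ‖v‖ ^ 2 := by fun_prop
  exact (h1.sub h2).congr fun v => by simp

/-- Lagrange multipliers for a convex function minimized on an affine space `{v | A v = c}`. -/
theorem exists_multiplier_of_isMinOn {S : E → ℝ} (hS : ConvexOn ℝ univ S) (A : E →ₗ[ℝ] F) {u : E}
    (hu : ∀ v, A v = A u → S u ≤ S v) :
    ∃ q : F, LinearMap.adjoint A q ∈ frechetSubdifferential S u := by
  have hcont : Continuous S := hS.locallyLipschitz.continuous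
  -- Minimality makes the open strict epigraph disjoint from the affine set {A v = A u} × {S u}; a
  -- separating hyperplane yields the multiplier.
  have hs : Convex ℝ {p : E × ℝ | p.1 ∈ univ ∧ S p.1 < p.2} := hS.convex_strict_epigraph
  have ho : IsOpen {p : E × ℝ | p.1 ∈ univ ∧ S p.1 < p.2} := by
    simpa using isOpen_lt (hcont.comp continuous_fst) continuous_snd
  have ht : Convex ℝ {p : E × ℝ | A p.1 = A u ∧ p.2 = S u} := by
    intro x hx y hy a b _ _ hab
    simp only [mem_ofPred_eq, Prod.fst_add, Prod.smul_fst, Prod.snd_add, Prod.smul_snd, map_add,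
      map_smul, hx.1, hx.2, hy.1, hy.2, ← add_smul, hab, one_smul, and_self]
  have hd : Disjoint {p : E × ℝ | p.1 ∈ univ ∧ S p.1 < p.2}
      {p : E × ℝ | A p.1 = A u ∧ p.2 = S u} := by
    rw [Set.disjoint_left]
    rintro ⟨v, r⟩ ⟨-, h1⟩ ⟨h2, h3⟩
    have := hu v h2
    simp only at h1 h3
    linarith
  obtain ⟨φ, m, hφ1, hφ2⟩ := geometric_hahn_banach_open hs ho ht hd
  set g : E →L[ℝ] ℝ := φ.comp (ContinuousLinearMap.inl ℝ E ℝ) with hg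
  set β : ℝ := φ (0, 1) with hβ
  have hφ : ∀ v r, φ (v, r) = g v + r * β := by
    intro v r
    have : ((v, r) : E × ℝ) = (v, 0) + r • (0, 1) := by simp
    rw [this, map_add, map_smul]; simp [hg, hβ]
  have h2 : ∀ v, A v = A u → m ≤ g v + S u * β := fun v hv => by
    rw [← hφ]; exact hφ2 _ ⟨hv, rfl⟩
  have h1 : ∀ v r, S v < r → g v + r * β < m := fun v r hr => by
    rw [← hφ]; exact hφ1 _ ⟨mem_univ _, hr⟩
  have hβ0 : β < 0 := by
    have a1 := h2 u rfl
    have a2 := h1 u (S u + 1) (by linarith)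
    linarith
  -- Otherwise a multiple of z brings the functional down to m - 1 on the affine set, where it is at
  -- least m.
  have hker : ∀ z, A z = 0 → g z = 0 := by
    intro z hz
    by_contra hne
    have := h2 (u + ((m - S u * β - g u - 1) / g z) • z) (by simp [hz])
    rw [map_add, map_smul, smul_eq_mul, div_mul_cancel₀ _ hne] at this
    linarith
  have hle : ∀ v, g v + S v * β ≤ g u + S u * β := by
    intro v
    refine (le_of_forall_pos_le_add fun ε hε => ?_ : g v + S v * β ≤ m).trans (h2 u rfl)
    have := h1 v (S v + ε / (-β)) (by have := div_pos hε (neg_pos.2 hβ0); linarith)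
    have e : ε / (-β) * β = -ε := by rw [div_neg, neg_mul, div_mul_cancel₀ _ hβ0.ne]
    nlinarith
  -- Since β < 0 the hyperplane is a graph, with slope ξ; vanishing on ker A puts ξ in the range of
  -- the adjoint.
  set ξ : E := (-β)⁻¹ • (InnerProductSpace.toDual ℝ E).symm g with hξ
  have hξi : ∀ v, inner ℝ ξ v = (-β)⁻¹ * g v := fun v => by
    rw [hξ, real_inner_smul_left, InnerProductSpace.toDual_symm_apply]
  have hmem : ξ ∈ (LinearMap.ker A)ᗮ := by
    rw [Submodule.mem_orthogonal']
    intro z hz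
    rw [hξi, hker z hz, mul_zero]
  rw [LinearMap.orthogonal_ker] at hmem
  obtain ⟨q, hq⟩ := hmem
  refine ⟨q, mem_frechetSubdifferential_of_le fun v => ?_⟩
  rw [hq, hξi, map_sub]
  have := hle v
  have hb : 0 < -β := neg_pos.2 hβ0
  rw [← sub_nonneg]
  have : S v - (S u + (-β)⁻¹ * (g v - g u)) = (-β)⁻¹ * (g u + S u * β - (g v + S v * β)) := by
    have hb' : β ≠ 0 := hβ0.ne
    field_simp
    ring
  rw [this]
  have : 0 ≤ g u + S u * β - (g v + S v * β) := by linarith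
  positivity

omit [FiniteDimensional ℝ E] in
/-- A global characterization of the subdifferential of a function whose quadratic perturbation is
convex. -/
theorem mem_frechetSubdifferential_iff {J : E → ℝ} {η : ℝ} (hη : 0 < η)
    (h : ConvexOn ℝ univ fun v => J v + η * ‖v‖ ^ 2) {u ξ : E} :
    ξ ∈ frechetSubdifferential J u ↔ ∀ v, J u + inner ℝ ξ (v - u) ≤ J v + η * ‖v - u‖ ^ 2 := by
  rw [← frechetSubdifferential_quadPerturbation_self J hη u]
  constructor
  · intro hξ v
    simpa [quadPerturbation] using
      (convexOn_quadPerturbation h u).le_of_mem_frechetSubdifferential hξ v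
  · intro hξ
    exact mem_frechetSubdifferential_of_le fun v => by simpa [quadPerturbation] using hξ v

/-- The global form of the subgradient inequality involves only continuous quantities, so it passes
to the limit. -/
theorem mem_frechetSubdifferential_of_tendsto {J : E → ℝ} {η : ℝ} (hη : 0 < η)
    (h : ConvexOn ℝ univ fun v => J v + η * ‖v‖ ^ 2) {ι : Type*} {l : Filter ι} [l.NeBot]
    {x ζ : ι → E} {u ξ : E} (hx : Tendsto x l (𝓝 u)) (hζ : Tendsto ζ l (𝓝 ξ))
    (hmem : ∀ i, ζ i ∈ frechetSubdifferential J (x i)) : ξ ∈ frechetSubdifferential J u := by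
  rw [mem_frechetSubdifferential_iff hη h]
  intro v
  have hJ := continuous_of_convexOn_add_sq h
  have hd : Tendsto (fun i => v - x i) l (𝓝 (v - u)) := tendsto_const_nhds.sub hx
  exact le_of_tendsto_of_tendsto' (((hJ.tendsto u).comp hx).add (hζ.inner hd))
    (tendsto_const_nhds.add ((hd.norm.pow 2).const_mul η))
    fun i => (mem_frechetSubdifferential_iff hη h).1 (hmem i) v

omit [FiniteDimensional ℝ F] in
theorem exists_isMin_of_tendsto_cobounded {S : E → ℝ} (hS : Continuous S) (A : E →ₗ[ℝ] F) (a : E)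
    (h : Tendsto S (Bornology.cobounded E ⊓ 𝓟 {v | A v = A a}) atTop) :
    ∃ u, A u = A a ∧ ∀ v, A v = A a → S u ≤ S v := by
  have hcl : IsClosed {v | A v = A a} :=
    isClosed_singleton.preimage (LinearMap.continuous_of_finiteDimensional A)
  obtain ⟨u, hu, hmin⟩ := hS.continuousOn.exists_isMinOn' hcl (x₀ := a) rfl (by
    rw [Metric.cobounded_eq_cocompact] at h
    exact h.eventually_ge_atTop _)
  exact ⟨u, hu, fun v hv => hmin hv⟩

theorem exists_le_of_mem_frechetSubdifferential {J : E → ℝ} (hJ : ∀ v, 0 ≤ J v) {A : E →ₗ[ℝ] F}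
    (hA : Function.Surjective A)
    (hJ1 : Tendsto (fun v => J v + ‖A v‖ ^ 2) (Bornology.cobounded E) atTop)
    {η : ℝ} (hη : 0 < η) (h : ConvexOn ℝ univ fun v => J v + η * ‖v‖ ^ 2) {C : ℝ}
    (hJ4 : ∀ (w v₁ v₂ : E) (q₁ q₂ : F),
      LinearMap.adjoint A q₁ ∈ frechetSubdifferential (quadPerturbation J η w) v₁ →
      LinearMap.adjoint A q₂ ∈ frechetSubdifferential (quadPerturbation J η w) v₂ →
      inner ℝ (q₁ - q₂) (A v₁ - A v₂) ≤ C * ‖v₁ - v₂‖ * ‖A v₁ - A v₂‖)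
    {w : E} {p : F} (hp : LinearMap.adjoint A p ∈ frechetSubdifferential J w) (c : F) :
    ∃ (u : E) (q : F), A u = c ∧ LinearMap.adjoint A q ∈ frechetSubdifferential J u ∧
      J u ≤ J w + inner ℝ p (c - A w) + C ^ 2 / (4 * η) * ‖c - A w‖ ^ 2 := by
  obtain ⟨a, rfl⟩ := hA c
  have hJc := continuous_of_convexOn_add_sq h
  -- On the affine space |A v| is constant, so (J1) makes J itself coercive there.
  obtain ⟨u, hu, hmin⟩ := exists_isMin_of_tendsto_cobounded hJc A a (by
    have h1 := (tendsto_atTop_add_const_right _ (-‖A a‖ ^ 2) hJ1).mono_left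
      (inf_le_left (b := 𝓟 {v | A v = A a}))
    refine h1.congr' (eventually_inf_principal.2 (Eventually.of_forall fun v hv => ?_))
    rw [mem_ofPred_eq] at hv
    rw [hv]; ring)
  obtain ⟨q, hq⟩ := exists_multiplier_of_isMinOn (convexOn_quadPerturbation h u) A (u := u)
    fun v hv => by
      have := hmin v (hv.trans hu)
      have : 0 ≤ η * ‖v - u‖ ^ 2 := by positivity
      simp only [quadPerturbation, sub_self, norm_zero]
      linarith
  rw [frechetSubdifferential_quadPerturbation_self J hη] at hq
  have hqc : Continuous (quadPerturbation J η w) := by unfold quadPerturbation; fun_prop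
  obtain ⟨v₁, hv₁, hmin₁⟩ := exists_isMin_of_tendsto_cobounded hqc A a (by
    refine Tendsto.mono_left ?_ inf_le_left
    have h1 : Tendsto (fun v => η * ‖v - w‖ ^ 2) (Bornology.cobounded E) atTop := by
      refine Tendsto.const_mul_atTop hη ((tendsto_pow_atTop two_ne_zero).comp ?_)
      refine tendsto_atTop_mono (fun v => ?_)
        (tendsto_atTop_add_const_right _ (-‖w‖) tendsto_norm_cobounded_atTop)
      linarith [norm_le_norm_sub_add v w]
    exact tendsto_atTop_mono (fun v => by unfold quadPerturbation; linarith [hJ v]) h1)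
  obtain ⟨q₁, hq₁⟩ := exists_multiplier_of_isMinOn (convexOn_quadPerturbation h w) A (u := v₁)
    fun v hv => hmin₁ v (hv.trans hv₁)
  refine ⟨u, q, hu, hq, (hmin v₁ hv₁).trans ?_⟩
  -- The two multipliers q₁ at v₁ and p at w belong to the same perturbed functional, because the
  -- perturbation is centred at w; hence (J4) applies to them.
  have e1 := (convexOn_quadPerturbation h w).le_of_mem_frechetSubdifferential hq₁ w
  rw [LinearMap.adjoint_inner_left, map_sub, hv₁] at e1
  simp only [quadPerturbation, sub_self, norm_zero] at e1
  have e2 := hJ4 w v₁ w q₁ p hq₁ (by rwa [frechetSubdifferential_quadPerturbation_self J hη])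
  rw [hv₁, inner_sub_left] at e2
  have e3 : inner ℝ q₁ (A w - A a) = - inner ℝ q₁ (A a - A w) := by
    rw [← inner_neg_right, neg_sub]
  have e4 : C * ‖v₁ - w‖ * ‖A a - A w‖ - η * ‖v₁ - w‖ ^ 2 ≤
      C ^ 2 / (4 * η) * ‖A a - A w‖ ^ 2 := by
    rw [div_mul_eq_mul_div, le_div_iff₀ (by positivity)]
    nlinarith [sq_nonneg (2 * η * ‖v₁ - w‖ - C * ‖A a - A w‖)]
  linarith

end Convex

/-! ### Fundamental theorem of calculus for W^{1,2} functions -/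

section WeakDerivative

variable {F : Type*} [NormedAddCommGroup F] [InnerProductSpace ℝ F]

theorem continuous_deriv_smoothTransition : Continuous (deriv Real.smoothTransition) :=
  (Real.smoothTransition.contDiff (n := 1)).continuous_deriv_one

theorem deriv_smoothTransition_of_notMem {x : ℝ} (hx : x ∉ Icc (0 : ℝ) 1) :
    deriv Real.smoothTransition x = 0 := by
  rcases lt_or_ge x 0 with h | h
  · have : Real.smoothTransition =ᶠ[𝓝 x] fun _ => 0 := by
      filter_upwards [Iio_mem_nhds h] with y hy
      exact Real.smoothTransition.zero_of_nonpos (le_of_lt hy)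
    rw [this.deriv_eq, deriv_const]
  · have h1 : 1 < x := by
      by_contra h1
      exact hx ⟨h, not_lt.1 h1⟩
    have : Real.smoothTransition =ᶠ[𝓝 x] fun _ => 1 := by
      filter_upwards [Ioi_mem_nhds h1] with y hy
      exact Real.smoothTransition.one_of_one_le (le_of_lt hy)
    rw [this.deriv_eq, deriv_const]

theorem hasCompactSupport_deriv_smoothTransition :
    HasCompactSupport (deriv Real.smoothTransition) :=
  HasCompactSupport.intro isCompact_Icc fun _ => deriv_smoothTransition_of_notMem

theorem integrable_deriv_smoothTransition : Integrable (deriv Real.smoothTransition) :=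
  continuous_deriv_smoothTransition.integrable_of_hasCompactSupport
    hasCompactSupport_deriv_smoothTransition

theorem integral_deriv_smoothTransition : ∫ x, deriv Real.smoothTransition x = 1 := by
  have h := integral_of_hasDerivAt_of_tendsto (f := Real.smoothTransition) (m := 0) (n := 1)
    (fun x => ((Real.smoothTransition.contDiff (n := 1)).differentiable
      one_ne_zero x).hasDerivAt) integrable_deriv_smoothTransition
    (tendsto_const_nhds.congr' ?_) (tendsto_const_nhds.congr' ?_)
  · simpa using h
  · filter_upwards [eventually_le_atBot 0] with x hx
    rw [Real.smoothTransition.zero_of_nonpos hx]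
  · filter_upwards [eventually_ge_atTop 1] with x hx
    rw [Real.smoothTransition.one_of_one_le hx]

/-- The rescaled derivatives of the smooth transition form an approximate identity. -/
theorem tendsto_integral_deriv_smoothTransition_smul [FiniteDimensional ℝ F] {h : ℝ → F}
    (hh : Continuous h)
    {B : ℝ} (hB : ∀ x, ‖h x‖ ≤ B) (a : ℝ) :
    Tendsto (fun n : ℕ => ∫ x, ((n + 1 : ℝ) * deriv Real.smoothTransition ((n + 1) * (x - a))) • h x)
      atTop (𝓝 (h a)) := by
  have key : ∀ n : ℕ, ∫ x, ((n + 1 : ℝ) * deriv Real.smoothTransition ((n + 1) * (x - a))) • h x =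
      ∫ y, deriv Real.smoothTransition y • h (a + (n + 1 : ℝ)⁻¹ * y) := by
    intro n
    have hn : (0 : ℝ) < n + 1 := by positivity
    rw [← integral_add_right_eq_self _ a]
    have := Measure.integral_comp_mul_left
      (fun y => ((n + 1 : ℝ) * deriv Real.smoothTransition y) • h (a + (n + 1 : ℝ)⁻¹ * y)) (n + 1)
    have e : ∀ x : ℝ, a + (n + 1 : ℝ)⁻¹ * ((n + 1) * x) = x + a := fun x => by
      field_simp; ring
    simp only [e] at this
    simp only [add_sub_cancel_right]
    rw [this]
    simp only [mul_smul]
    rw [integral_smul, smul_smul, abs_of_pos (inv_pos.2 hn), inv_mul_cancel₀ hn.ne', one_smul]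
  simp only [key]
  have hlim : Tendsto (fun n : ℕ => ∫ y, deriv Real.smoothTransition y • h (a + (n + 1 : ℝ)⁻¹ * y))
      atTop (𝓝 (∫ y, deriv Real.smoothTransition y • h a)) := by
    refine tendsto_integral_of_dominated_convergence
      (fun y => ‖deriv Real.smoothTransition y‖ * B) (fun n => ?_)
      (integrable_deriv_smoothTransition.norm.mul_const B)
      (fun n => Eventually.of_forall fun y => ?_) (Eventually.of_forall fun y => ?_)
    · exact (continuous_deriv_smoothTransition.smul
        (hh.comp (by fun_prop))).aestronglyMeasurable
    · rw [norm_smul]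
      exact mul_le_mul_of_nonneg_left (hB _) (norm_nonneg _)
    · refine Tendsto.const_smul ?_ _
      refine (hh.tendsto a).comp ?_
      have : Tendsto (fun n : ℕ => a + (n + 1 : ℝ)⁻¹ * y) atTop (𝓝 (a + 0 * y)) := by
        have := tendsto_one_div_add_atTop_nhds_zero_nat (𝕜 := ℝ)
        simp only [one_div] at this
        exact tendsto_const_nhds.add (this.mul_const y)
      simpa using this
  rwa [integral_smul_const, integral_deriv_smoothTransition, one_smul] at hlim

theorem HasW12Deriv.integrableOn [FiniteDimensional ℝ F] {T : ℝ} {f f' : ℝ → F}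
    (hf : HasW12Deriv T f f') : IntegrableOn f' (Ioo 0 T) :=
  hf.memLp_deriv.integrable (by norm_num)

/-- The weak derivative is tested with smooth approximations φ n of the indicator of (a, b]: their
derivatives tend to a Dirac mass at a minus one at b. -/
theorem HasW12Deriv.sub_eq_setIntegral [FiniteDimensional ℝ F] {T : ℝ} {f f' : ℝ → F}
    (hf : HasW12Deriv T f f') {a b : ℝ} (ha : 0 < a) (hab : a ≤ b) (hb : b < T) :
    f b - f a = ∫ s in Ioc a b, f' s := by
  have hT : 0 ≤ T := by linarith
  set s := Real.smoothTransition
  set φ : ℕ → ℝ → ℝ := fun n x => s ((n + 1) * (x - a)) - s ((n + 1) * (x - b)) with hφ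
  have hs : ContDiff ℝ ∞ s := Real.smoothTransition.contDiff (n := ⊤)
  have hφc : ∀ n, ContDiff ℝ ∞ (φ n) := fun n =>
    (hs.comp (by fun_prop)).sub (hs.comp (by fun_prop))
  have hsupp : ∀ n : ℕ, ∀ x ∉ Icc a (b + 1 / (n + 1 : ℝ)), φ n x = 0 := by
    intro n x hx
    have hn : (0 : ℝ) < n + 1 := by positivity
    rcases lt_or_ge x a with h | h
    · have h1 : (n + 1 : ℝ) * (x - a) ≤ 0 := mul_nonpos_of_nonneg_of_nonpos hn.le (by linarith)
      have h2 : (n + 1 : ℝ) * (x - b) ≤ 0 := mul_nonpos_of_nonneg_of_nonpos hn.le (by linarith)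
      simp only [hφ, s, Real.smoothTransition.zero_of_nonpos h1,
        Real.smoothTransition.zero_of_nonpos h2, sub_self]
    · have h0 : b + 1 / (n + 1 : ℝ) < x := by
        by_contra h0
        exact hx ⟨h, not_lt.1 h0⟩
      have h2 : 1 ≤ (n + 1 : ℝ) * (x - b) := by
        have : 1 / (n + 1 : ℝ) ≤ x - b := by linarith
        rwa [div_le_iff₀' hn] at this
      have h1 : 1 ≤ (n + 1 : ℝ) * (x - a) := h2.trans (by gcongr)
      simp only [hφ, s, Real.smoothTransition.one_of_one_le h1,
        Real.smoothTransition.one_of_one_le h2, sub_self]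
  have hts : ∀ n : ℕ, tsupport (φ n) ⊆ Icc a (b + 1 / (n + 1 : ℝ)) := fun n =>
    closure_minimal (fun x hx => by_contra fun h => hx (hsupp n x h)) isClosed_Icc
  have hev : ∀ᶠ n : ℕ in atTop, tsupport (φ n) ⊆ Ioo 0 T := by
    have h1 := tendsto_one_div_add_atTop_nhds_zero_nat (𝕜 := ℝ)
    filter_upwards [h1.eventually (Iio_mem_nhds (sub_pos.2 hb))] with n hn x hx
    have := hts n hx
    have hn : 1 / (n + 1 : ℝ) < T - b := hn
    exact ⟨by linarith [this.1], by linarith [this.2]⟩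
  -- A bounded continuous extension of f, as the approximate identity requires.
  set h : ℝ → F := fun x => f (projIcc 0 T hT x) with hh
  have hhc : Continuous h := hf.continuousOn.comp_continuous
    (continuous_subtype_val.comp continuous_projIcc) fun x => (projIcc 0 T hT x).2
  obtain ⟨B, hB⟩ := isCompact_Icc.exists_bound_of_continuousOn hf.continuousOn
  have hhB : ∀ x, ‖h x‖ ≤ B := fun x => hB _ (projIcc 0 T hT x).2
  have hhf : ∀ x ∈ Icc 0 T, h x = f x := fun x hx => by simp [hh, projIcc_of_mem hT hx]
  have hderiv : ∀ (n : ℕ) x, deriv (φ n) x =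
      (n + 1) * deriv s ((n + 1) * (x - a)) - (n + 1) * deriv s ((n + 1) * (x - b)) := by
    intro n x
    have hd : ∀ c, HasDerivAt (fun x => s ((n + 1) * (x - c)))
        ((n + 1) * deriv s ((n + 1) * (x - c))) x := fun c => by
      have h1 : HasDerivAt (fun x : ℝ => (n + 1 : ℝ) * (x - c)) ((n + 1 : ℝ) * 1) x :=
        ((hasDerivAt_id x).sub_const c).const_mul _
      have h2 := ((hs.differentiable (by simp)) ((n + 1) * (x - c))).hasDerivAt
      simpa [mul_comm, Function.comp_def] using h2.comp x h1
    exact ((hd a).sub (hd b)).deriv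
  have hint : ∀ (n : ℕ) c, Integrable fun x => ((n + 1 : ℝ) * deriv s ((n + 1) * (x - c))) • h x := by
    intro n c
    have hn : (n + 1 : ℝ) ≠ 0 := by positivity
    have h1 : Integrable fun x => (n + 1 : ℝ) * deriv s ((n + 1) * (x - c)) :=
      (((integrable_deriv_smoothTransition.comp_mul_left' hn).comp_sub_right c).const_mul _)
    exact h1.smul_bdd B hhc.aestronglyMeasurable (Eventually.of_forall hhB)
  have hlim1 : Tendsto (fun n => ∫ t in Ioo 0 T, deriv (φ n) t • f t) atTop (𝓝 (f a - f b)) := by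
    have h1 := (tendsto_integral_deriv_smoothTransition_smul hhc hhB a).sub
      (tendsto_integral_deriv_smoothTransition_smul hhc hhB b)
    rw [hhf a ⟨ha.le, by linarith⟩, hhf b ⟨by linarith, hb.le⟩] at h1
    refine h1.congr' ?_
    filter_upwards [hev] with n hn
    rw [← integral_sub (hint n a) (hint n b)]
    have h2 : ∫ t in Ioo 0 T, deriv (φ n) t • f t = ∫ t in Ioo 0 T, deriv (φ n) t • h t :=
      setIntegral_congr_fun measurableSet_Ioo fun t ht => by
        simp only [hhf t (Ioo_subset_Icc_self ht)]
    rw [h2, setIntegral_eq_integral_of_forall_compl_eq_zero]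
    · exact integral_congr_ae (Eventually.of_forall fun t => by
        simp only [hderiv, sub_smul, s])
    · intro t ht
      have : deriv (φ n) t = 0 := by
        by_contra h0
        exact ht (hn (support_deriv_subset h0))
      rw [this, zero_smul]
  have hlim2 : Tendsto (fun n => ∫ t in Ioo 0 T, φ n t • f' t) atTop
      (𝓝 (∫ t in Ioo 0 T, (Ioc a b).indicator f' t)) := by
    refine tendsto_integral_of_dominated_convergence (fun t => ‖f' t‖)
      (fun n => (hφc n).continuous.aestronglyMeasurable.smul hf.integrableOn.1)
      hf.integrableOn.norm (fun n => Eventually.of_forall fun t => ?_)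
      (Eventually.of_forall fun t => ?_)
    · rw [norm_smul]
      refine mul_le_of_le_one_left (norm_nonneg _) ?_
      rw [Real.norm_eq_abs, abs_le]
      have := Real.smoothTransition.nonneg ((n + 1) * (t - a))
      have := Real.smoothTransition.nonneg ((n + 1) * (t - b))
      have := Real.smoothTransition.le_one ((n + 1) * (t - a))
      have := Real.smoothTransition.le_one ((n + 1) * (t - b))
      simp only [hφ, s]
      constructor <;> linarith
    -- Each transition starts at its own threshold, so the pointwise limit excludes a and includes
    -- b.
    · have hz : ∀ c, t ≤ c → ∀ n : ℕ, s ((n + 1) * (t - c)) = 0 := fun c hc n =>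
        Real.smoothTransition.zero_of_nonpos
          (mul_nonpos_of_nonneg_of_nonpos (by positivity) (by linarith))
      have ho : ∀ c, c < t → ∀ᶠ n : ℕ in atTop, s ((n + 1) * (t - c)) = 1 := fun c hc => by
        have h1 := tendsto_one_div_add_atTop_nhds_zero_nat (𝕜 := ℝ)
        filter_upwards [h1.eventually (Iio_mem_nhds (sub_pos.2 hc))] with n hn
        have hn : 1 / (n + 1 : ℝ) < t - c := hn
        rw [div_lt_iff₀' (by positivity)] at hn
        exact Real.smoothTransition.one_of_one_le hn.le
      refine tendsto_const_nhds.congr' ?_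
      rcases le_or_gt t a with h1 | h1
      · refine Eventually.of_forall fun n => ?_
        simp [hφ, hz a h1 n, hz b (h1.trans hab) n, h1]
      rcases le_or_gt t b with h2 | h2
      · filter_upwards [ho a h1] with n hn
        simp [hφ, hn, hz b h2 n, h1, h2]
      · filter_upwards [ho a h1, ho b h2] with n hn hn'
        simp [hφ, hn, hn', h2]
  have hlim3 := hlim1.congr' (hev.mono fun n hn => hf.integral_eq (φ n) (hφc n)
    (HasCompactSupport.intro isCompact_Icc (hsupp n)) hn)
  have huniq := tendsto_nhds_unique hlim3 hlim2.neg
  have hsub : Ioc a b ⊆ Ioo 0 T := fun x hx => ⟨ha.trans hx.1, hx.2.trans_lt hb⟩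
  rw [setIntegral_indicator measurableSet_Ioc, inter_eq_self_of_subset_right hsub] at huniq
  rw [← neg_sub, huniq, neg_neg]

/-- The fundamental theorem of calculus for `W^{1,2}` functions, with a measurable representative
of the weak derivative. -/
theorem HasW12Deriv.exists_measurable_deriv [FiniteDimensional ℝ F] [MeasurableSpace F]
    [BorelSpace F] {T : ℝ} (hT : 0 < T) {f f' : ℝ → F} (hf : HasW12Deriv T f f') :
    ∃ g : ℝ → F, Measurable g ∧ Integrable g ∧ f' =ᵐ[volume.restrict (Ioo 0 T)] g ∧
      ∀ a ∈ Icc 0 T, ∀ b ∈ Icc 0 T, f b - f a = ∫ s in a..b, g s := by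
  have hi := hf.integrableOn
  set g₀ := hi.1.mk f'
  have hg₀ : f' =ᵐ[volume.restrict (Ioo 0 T)] g₀ := hi.1.ae_eq_mk
  set g := (Ioo 0 T).indicator g₀
  have hg : f' =ᵐ[volume.restrict (Ioo 0 T)] g :=
    hg₀.trans (indicator_ae_eq_restrict measurableSet_Ioo).symm
  have hgi : Integrable g := by
    rw [integrable_indicator_iff measurableSet_Ioo]
    exact hi.congr hg₀
  refine ⟨g, hi.1.stronglyMeasurable_mk.measurable.indicator measurableSet_Ioo, hgi, hg, ?_⟩
  -- H is constant on the open interval by the previous lemma, and up to the endpoints by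
  -- continuity.
  set H : ℝ → F := fun t => f t - ∫ s in 0..t, g s with hH
  have hc : ContinuousOn H (Icc 0 T) := hf.continuousOn.sub
    (intervalIntegral.continuous_primitive (fun _ _ => hgi.intervalIntegrable) 0).continuousOn
  have hsub : ∀ a b, f b - f a - ∫ s in a..b, g s = H b - H a := fun a b => by
    rw [← intervalIntegral.integral_interval_sub_left (a := 0) hgi.intervalIntegrable
      hgi.intervalIntegrable]
    simp only [hH]; abel
  have hmono : ∀ a ∈ Ioo 0 T, ∀ b ∈ Ioo 0 T, a ≤ b → H b = H a := by
    intro a ha b hb hab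
    rw [← sub_eq_zero, ← hsub, hf.sub_eq_setIntegral ha.1 hab hb.2, sub_eq_zero,
      intervalIntegral.integral_of_le hab]
    refine integral_congr_ae (ae_restrict_of_ae_restrict_of_subset ?_ hg)
    exact fun x hx => ⟨ha.1.trans hx.1, hx.2.trans_lt hb.2⟩
  have hmid : T / 2 ∈ Ioo 0 T := ⟨by linarith, by linarith⟩
  have heq : EqOn H (fun _ => H (T / 2)) (Icc 0 T) := by
    refine EqOn.of_subset_closure (s := Ioo 0 T) (fun t ht => ?_) hc continuousOn_const
      Ioo_subset_Icc_self (closure_Ioo hT.ne).ge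
    rcases le_total t (T / 2) with h | h
    · exact (hmono t ht _ hmid h).symm
    · exact hmono _ hmid t ht h
  intro a ha b hb
  rw [← sub_eq_zero, hsub, heq ha, heq hb, sub_self]

end WeakDerivative

/-! ### Discrete evolutions and their energy estimates -/

section DiscreteEvolution

variable {E F : Type*} [NormedAddCommGroup E] [InnerProductSpace ℝ E] [FiniteDimensional ℝ E]
  [NormedAddCommGroup F] [InnerProductSpace ℝ F] [FiniteDimensional ℝ F]

/-- Iteration of a one-step existence statement along a sequence of constraints. -/
theorem exists_seq_of_step {J : E → ℝ} {A : E →ₗ[ℝ] F} {K : ℝ}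
    (hstep : ∀ (w : E) (p c : F), LinearMap.adjoint A p ∈ frechetSubdifferential J w →
      ∃ (u : E) (q : F), A u = c ∧ LinearMap.adjoint A q ∈ frechetSubdifferential J u ∧
        J u ≤ J w + inner ℝ p (c - A w) + K * ‖c - A w‖ ^ 2)
    {v₀ : E} {p₀ : F} (hp₀ : LinearMap.adjoint A p₀ ∈ frechetSubdifferential J v₀)
    (c : ℕ → F) (hc : A v₀ = c 0) :
    ∃ (x : ℕ → E) (p : ℕ → F), x 0 = v₀ ∧ (∀ i, A (x i) = c i) ∧
      (∀ i, LinearMap.adjoint A (p i) ∈ frechetSubdifferential J (x i)) ∧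
      ∀ i, J (x (i + 1)) ≤ J (x i) + inner ℝ (p i) (c (i + 1) - c i) +
        K * ‖c (i + 1) - c i‖ ^ 2 := by
  choose! U Q hU hQ hE using hstep
  let z : ℕ → E × F := fun n => Nat.rec (v₀, p₀)
    (fun i z => (U z.1 z.2 (c (i + 1)), Q z.1 z.2 (c (i + 1)))) n
  have hz : ∀ i, LinearMap.adjoint A (z i).2 ∈ frechetSubdifferential J (z i).1 := by
    intro i
    induction i with
    | zero => exact hp₀
    | succ i ih => exact hQ _ _ _ ih
  have hA : ∀ i, A (z i).1 = c i := by
    intro i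
    cases i with
    | zero => exact hc
    | succ i => exact hU _ _ _ (hz i)
  refine ⟨fun i => (z i).1, fun i => (z i).2, rfl, hA, hz, fun i => ?_⟩
  have := hE (z i).1 (z i).2 (c (i + 1)) (hz i)
  rwa [hA i] at this

omit [FiniteDimensional ℝ F] in
theorem norm_sub_le_integral_norm {T : ℝ} {f g : ℝ → F}
    (hfg : ∀ a ∈ Icc 0 T, ∀ b ∈ Icc 0 T, f b - f a = ∫ s in a..b, g s) {a b : ℝ}
    (ha : 0 ≤ a) (hab : a ≤ b) (hb : b ≤ T) : ‖f b - f a‖ ≤ ∫ s in a..b, ‖g s‖ := by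
  rw [hfg a ⟨ha, hab.trans hb⟩ b ⟨ha.trans hab, hb⟩]
  exact intervalIntegral.norm_integral_le_integral_norm hab

omit [InnerProductSpace ℝ F] [FiniteDimensional ℝ F] in
theorem intervalIntegral_norm_le_integral {g : ℝ → F} (hg : Integrable g) {a b : ℝ} (hab : a ≤ b) :
    ∫ s in a..b, ‖g s‖ ≤ ∫ s, ‖g s‖ := by
  rw [intervalIntegral.integral_of_le hab]
  exact setIntegral_le_integral hg.norm (Eventually.of_forall fun _ => norm_nonneg _)

omit [NormedAddCommGroup E] [InnerProductSpace ℝ E] [FiniteDimensional ℝ E]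
  [FiniteDimensional ℝ F] in
/-- A discrete Grönwall estimate for the energy along a sequence of constrained critical points. -/
theorem energy_le_of_step {J : E → ℝ} (hJ : ∀ v, 0 ≤ J v) {T : ℝ} {f g : ℝ → F}
    (hg : Integrable g)
    (hfg : ∀ a ∈ Icc 0 T, ∀ b ∈ Icc 0 T, f b - f a = ∫ s in a..b, g s) {K Λ : ℝ} (hK : 0 ≤ K)
    (hΛ : 0 ≤ Λ) {δ : ℝ} (hδ : 0 < δ) {x : ℕ → E} {p : ℕ → F}
    (hp : ∀ i, ‖p i‖ ≤ Λ * (J (x i) + 1))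
    (hx : ∀ i : ℕ, J (x (i + 1)) ≤ J (x i) +
      inner ℝ (p i) (f ((i + 1 : ℕ) * δ) - f (i * δ)) +
        K * ‖f ((i + 1 : ℕ) * δ) - f (i * δ)‖ ^ 2) (i : ℕ) (hi : i * δ ≤ T) :
    J (x i) + 1 ≤ (J (x 0) + 1) *
      Real.exp ((Λ + K * ∫ s, ‖g s‖) * ∫ s in (0 : ℝ)..(i * δ), ‖g s‖) := by
  set G := ∫ s, ‖g s‖
  have hG : 0 ≤ G := integral_nonneg fun _ => norm_nonneg _
  induction i with
  | zero => simp
  | succ i ih =>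
    have hle : (i : ℝ) * δ ≤ (i + 1 : ℕ) * δ := by push_cast; nlinarith
    have h0 : (0 : ℝ) ≤ i * δ := by positivity
    set b := ∫ s in (i * δ : ℝ)..((i + 1 : ℕ) * δ), ‖g s‖
    have hb : ‖f ((i + 1 : ℕ) * δ) - f (i * δ)‖ ≤ b := norm_sub_le_integral_norm hfg h0 hle hi
    have hb0 : 0 ≤ b := (norm_nonneg _).trans hb
    have hbG : b ≤ G := intervalIntegral_norm_le_integral hg hle
    have hJi := hJ (x i)
    -- One factor b of the quadratic error is bounded by G, and J ≥ 0 allows the factor J + 1; then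
    -- 1 + y ≤ exp y closes the induction.
    have h1 : J (x (i + 1)) + 1 ≤ (J (x i) + 1) * ((Λ + K * G) * b + 1) := by
      have e1 : inner ℝ (p i) (f ((i + 1 : ℕ) * δ) - f (i * δ)) ≤ Λ * (J (x i) + 1) * b :=
        (real_inner_le_norm _ _).trans
          (mul_le_mul (hp i) hb (norm_nonneg _) (by positivity))
      have e2 : K * ‖f ((i + 1 : ℕ) * δ) - f (i * δ)‖ ^ 2 ≤ K * (G * b) := by
        refine mul_le_mul_of_nonneg_left ?_ hK
        rw [pow_two]
        exact mul_le_mul (hb.trans hbG) hb (norm_nonneg _) hG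
      have e3 : 0 ≤ K * (G * b) * J (x i) := by positivity
      nlinarith [hx i]
    have hsplit : ∫ s in (0 : ℝ)..((i + 1 : ℕ) * δ), ‖g s‖ =
        (∫ s in (0 : ℝ)..(i * δ), ‖g s‖) + b :=
      (intervalIntegral.integral_add_adjacent_intervals hg.norm.intervalIntegrable
        hg.norm.intervalIntegrable).symm
    rw [hsplit, mul_add, Real.exp_add, ← mul_assoc]
    exact h1.trans (mul_le_mul (ih (hle.trans hi)) (Real.add_one_le_exp _) (by positivity)
      (mul_nonneg (by linarith [hJ (x 0)]) (Real.exp_nonneg _)))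

omit [NormedAddCommGroup E] [InnerProductSpace ℝ E] [FiniteDimensional ℝ E] in
/-- The energy inequality along the piecewise constant interpolation, at the grid points. -/
theorem energy_le_integral_of_step {J : E → ℝ} {T : ℝ} {f g : ℝ → F}
    (hg : Integrable g)
    (hfg : ∀ a ∈ Icc 0 T, ∀ b ∈ Icc 0 T, f b - f a = ∫ s in a..b, g s) {K : ℝ} (hK : 0 ≤ K)
    {δ ε : ℝ} (hδ : 0 < δ)
    (hε : ∀ s ∈ Icc 0 T, ∀ t ∈ Icc s T, t - s ≤ δ → ∫ r in s..t, ‖g r‖ ≤ ε)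
    {x : ℕ → E} {p : ℕ → F}
    (hx : ∀ i : ℕ, J (x (i + 1)) ≤ J (x i) +
      inner ℝ (p i) (f ((i + 1 : ℕ) * δ) - f (i * δ)) +
        K * ‖f ((i + 1 : ℕ) * δ) - f (i * δ)‖ ^ 2)
    {q : ℝ → F} (hq : ∀ i : ℕ, ∀ t ∈ Ico ((i : ℝ) * δ) ((i + 1 : ℕ) * δ), t < T → q t = p i)
    (hqi : Integrable fun s => (inner ℝ (q s) (g s) : ℝ))
    (i : ℕ) (hi : i * δ ≤ T) :
    J (x i) ≤ J (x 0) + (∫ s in (0 : ℝ)..(i * δ), inner ℝ (q s) (g s)) +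
      K * ε * ∫ s in (0 : ℝ)..(i * δ), ‖g s‖ := by
  induction i with
  | zero => simp
  | succ i ih =>
    have hle : (i : ℝ) * δ ≤ (i + 1 : ℕ) * δ := by push_cast; nlinarith
    have h0 : (0 : ℝ) ≤ i * δ := by positivity
    have hb := norm_sub_le_integral_norm hfg h0 hle hi
    have hbε := hε _ ⟨h0, hle.trans hi⟩ _ ⟨hle, hi⟩ (by push_cast; linarith)
    have hb0 := (norm_nonneg _).trans hb
    -- The multiplier is constant on the cell [iδ, (i+1)δ), so the work of the step is exactly the
    -- integral of the power.
    have h1 : inner ℝ (p i) (f ((i + 1 : ℕ) * δ) - f (i * δ)) =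
        ∫ s in (i * δ : ℝ)..((i + 1 : ℕ) * δ), inner ℝ (q s) (g s) := by
      rw [hfg _ ⟨h0, hle.trans hi⟩ _ ⟨h0.trans hle, hi⟩, intervalIntegral.integral_of_le hle,
        intervalIntegral.integral_of_le hle, ← integral_inner hg.integrableOn,
        ← integral_Ico_eq_integral_Ioc, ← integral_Ico_eq_integral_Ioc]
      exact setIntegral_congr_fun measurableSet_Ico fun t ht => by
        simp only [hq i t ht (ht.2.trans_le hi)]
    have h2 : K * ‖f ((i + 1 : ℕ) * δ) - f (i * δ)‖ ^ 2 ≤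
        K * ε * ∫ s in (i * δ : ℝ)..((i + 1 : ℕ) * δ), ‖g s‖ := by
      rw [mul_assoc, pow_two]
      exact mul_le_mul_of_nonneg_left (mul_le_mul (hb.trans hbε) hb (norm_nonneg _)
        (hb0.trans hbε)) hK
    rw [← intervalIntegral.integral_add_adjacent_intervals (a := 0) (b := i * δ)
        hqi.intervalIntegrable hqi.intervalIntegrable,
      ← intervalIntegral.integral_add_adjacent_intervals (a := 0) (b := i * δ)
        hg.norm.intervalIntegrable hg.norm.intervalIntegrable]
    have h3 := hx i
    have h4 := ih (hle.trans hi)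
    linarith

theorem exists_discreteEvolution [MeasurableSpace E] [MeasurableSpace F] [BorelSpace F]
    {J : E → ℝ} (hJ : ∀ v, 0 ≤ J v) {A : E →ₗ[ℝ] F} {K Λ : ℝ} (hK : 0 ≤ K) (hΛ : 0 ≤ Λ)
    (hstep : ∀ (w : E) (p c : F), LinearMap.adjoint A p ∈ frechetSubdifferential J w →
      ∃ (u : E) (q : F), A u = c ∧ LinearMap.adjoint A q ∈ frechetSubdifferential J u ∧
        J u ≤ J w + inner ℝ p (c - A w) + K * ‖c - A w‖ ^ 2)
    (hbound : ∀ (w : E) (p : F), LinearMap.adjoint A p ∈ frechetSubdifferential J w →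
      ‖p‖ ≤ Λ * (J w + 1))
    {T : ℝ} (hT : 0 < T) {f g : ℝ → F} (hgm : Measurable g) (hg : Integrable g)
    (hfg : ∀ a ∈ Icc 0 T, ∀ b ∈ Icc 0 T, f b - f a = ∫ s in a..b, g s)
    {v₀ : E} (hv₀ : IsConstrainedCriticalPoint A J (f 0) v₀) :
    ∃ R D : ℝ, ∀ δ > 0, ∀ ε ≥ 0,
      (∀ s ∈ Icc 0 T, ∀ t ∈ Icc s T, t - s ≤ δ → ∫ r in s..t, ‖g r‖ ≤ ε) →
      ∃ (w : ℝ → E) (q : ℝ → F), Measurable w ∧ Measurable q ∧ IsDiscreteEvolution A J f T v₀ δ w ∧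
        (∀ t, LinearMap.adjoint A (q t) ∈ frechetSubdifferential J (w t)) ∧
        (∀ t, J (w t) ≤ R) ∧ (∀ t, ∃ s ∈ Icc 0 T, A (w t) = f s) ∧
        ∀ t ∈ Icc 0 T, J (w t) ≤ J v₀ + (∫ s in (0 : ℝ)..t, inner ℝ (q s) (g s)) + D * ε := by
  obtain ⟨hv₀c, _, hp₀, p₀, rfl⟩ := hv₀
  set G := ∫ s, ‖g s‖ with hGdef
  have hG : 0 ≤ G := integral_nonneg fun _ => norm_nonneg _
  set R := (J v₀ + 1) * Real.exp ((Λ + K * G) * G)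
  -- K G accounts for the quadratic errors, Λ (R + 1) for the power on the last, incomplete cell.
  refine ⟨R, K * G + Λ * (R + 1), fun δ hδ ε hε0 hε => ?_⟩
  obtain ⟨x, p, hx0, hxA, hp, hx⟩ := exists_seq_of_step hstep hp₀ (fun i : ℕ => f (i * δ))
    (by simpa using hv₀c)
  have hR : ∀ i : ℕ, i * δ ≤ T → J (x i) ≤ R := by
    intro i hi
    have h1 := energy_le_of_step hJ hg hfg hK hΛ hδ (fun i => hbound _ _ (hp i)) hx i hi
    rw [hx0] at h1
    have h2 : (∫ s in (0 : ℝ)..(i * δ), ‖g s‖) ≤ G :=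
      intervalIntegral_norm_le_integral hg (by positivity)
    have h3 : (J v₀ + 1) * Real.exp ((Λ + K * G) * ∫ s in (0 : ℝ)..(i * δ), ‖g s‖) ≤ R := by
      have := hJ v₀
      simp only [R]
      gcongr
    linarith
  -- The cell containing t. Truncation at T keeps the grid point in [0, T], and the natural floor
  -- gives 0 at negative times, so the bounds hold for every real t.
  set N : ℝ → ℕ := fun t => ⌊min t T / δ⌋₊ with hN
  have hNm : Measurable N := Nat.measurable_floor.comp (by fun_prop)
  have hNT : ∀ t, (N t : ℝ) * δ ≤ T := by
    intro t
    rcases le_or_gt 0 (min t T) with h | h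
    · have := Nat.floor_le (div_nonneg h hδ.le)
      rw [le_div_iff₀ hδ] at this
      exact this.trans (min_le_right _ _)
    · have : N t = 0 := Nat.floor_of_nonpos (div_nonpos_of_nonpos_of_nonneg h.le hδ.le)
      rw [this]; simpa using hT.le
  have hNeq : ∀ i : ℕ, ∀ t ∈ Ico ((i : ℝ) * δ) ((i + 1 : ℕ) * δ), t ≤ T → N t = i := by
    intro i t ht htT
    simp only [hN, min_eq_left htT]
    rw [Nat.floor_eq_iff (div_nonneg (by nlinarith [ht.1, (Nat.cast_nonneg i : (0 : ℝ) ≤ i)]) hδ.le),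
      le_div_iff₀ hδ, div_lt_iff₀ hδ]
    exact_mod_cast ht
  have hNgrid : ∀ i : ℕ, (i : ℝ) * δ ≤ T → N (i * δ) = i := fun i hi =>
    hNeq i _ ⟨le_rfl, by push_cast; nlinarith⟩ hi
  have hNz : ∀ t < δ, N t = 0 := by
    intro t ht
    rw [hN]
    simp only [Nat.floor_eq_zero]
    rw [div_lt_one hδ]
    exact (min_le_left _ _).trans_lt ht
  have hNmem : ∀ t ∈ Icc 0 T, t ∈ Ico ((N t : ℝ) * δ) ((N t + 1 : ℕ) * δ) := by
    intro t ht
    have h1 := Nat.floor_le (div_nonneg ht.1 hδ.le)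
    have h2 := Nat.lt_floor_add_one (t / δ)
    rw [le_div_iff₀ hδ] at h1
    rw [div_lt_iff₀ hδ] at h2
    simp only [hN, min_eq_left ht.2]
    exact ⟨h1, by exact_mod_cast h2⟩
  have hqm : Measurable fun t => p (N t) := (measurable_from_nat (f := p)).comp hNm
  have hqb : ∀ t, ‖p (N t)‖ ≤ Λ * (R + 1) := fun t => (hbound _ _ (hp _)).trans
    (mul_le_mul_of_nonneg_left (by linarith [hR _ (hNT t)]) hΛ)
  have hqi : Integrable fun s => (inner ℝ (p (N s)) (g s) : ℝ) := by
    refine (hg.norm.const_mul (Λ * (R + 1))).mono' (hqm.inner hgm).aestronglyMeasurable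
      (Eventually.of_forall fun s => (norm_inner_le_norm _ _).trans ?_)
    exact mul_le_mul_of_nonneg_right (hqb s) (norm_nonneg _)
  refine ⟨fun t => x (N t), fun t => p (N t), (measurable_from_nat (f := x)).comp hNm, hqm, ?_,
    fun t => hp _, fun t => hR _ (hNT t), fun t => ⟨N t * δ, ⟨by positivity, hNT t⟩, hxA _⟩, ?_⟩
  · refine ⟨fun t ht => ?_, fun t _ ht => by simp only [hNz t ht, hx0], fun i hi t ht => ?_,
      fun i hi => ?_⟩
    · have hloc : ∃ b > t, ∀ s ∈ Ico t b, s ≤ T → N s = N t := by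
        rcases lt_or_ge t 0 with h | h
        · exact ⟨δ, by linarith, fun s hs _ => by rw [hNz s hs.2, hNz t (by linarith)]⟩
        · have h1 := hNmem t ⟨h, ht.2⟩
          exact ⟨_, h1.2, fun s hs hsT => hNeq _ s ⟨h1.1.trans hs.1, hs.2⟩ hsT⟩
      obtain ⟨b, hb, hloc⟩ := hloc
      refine continuousWithinAt_const.congr_of_eventuallyEq (f := fun _ => x (N t)) ?_ rfl
      filter_upwards [self_mem_nhdsWithin, nhdsWithin_le_nhds (Iio_mem_nhds hb)] with s hs hsb
      rw [hloc s ⟨hs.2, hsb⟩ hs.1.2]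
    · rw [hNgrid i hi, hNeq i t (by simpa using ht.2) ht.1.2]
    · simp only [hNgrid i hi]
      exact ⟨hxA i, _, hp i, p i, rfl⟩
  · intro t ht
    have hm := hNmem t ht
    have h0 : (0 : ℝ) ≤ N t * δ := by positivity
    have h1 := energy_le_integral_of_step hg hfg hK hδ hε hx (q := fun t => p (N t))
      (fun i s hs hsT => by simp only [hNeq i s hs hsT.le]) hqi (N t) (hNT t)
    have h2 : K * ε * (∫ s in (0 : ℝ)..(N t * δ), ‖g s‖) ≤ K * ε * G :=
      mul_le_mul_of_nonneg_left (intervalIntegral_norm_le_integral hg h0) (by positivity)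
    have h3 : -(∫ s in (N t * δ : ℝ)..t, inner ℝ (p (N s)) (g s)) ≤ Λ * (R + 1) * ε := by
      refine (neg_le_abs _).trans ?_
      have e1 : |∫ s in (N t * δ : ℝ)..t, inner ℝ (p (N s)) (g s)| ≤
          ∫ s in (N t * δ : ℝ)..t, Λ * (R + 1) * ‖g s‖ := by
        rw [← Real.norm_eq_abs]
        refine intervalIntegral.norm_integral_le_of_norm_le hm.1 (Eventually.of_forall fun s _ => ?_)
          (hg.norm.const_mul _).intervalIntegrable
        exact (norm_inner_le_norm _ _).trans (mul_le_mul_of_nonneg_right (hqb s) (norm_nonneg _))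
      rw [intervalIntegral.integral_const_mul] at e1
      refine e1.trans (mul_le_mul_of_nonneg_left ?_ ((norm_nonneg _).trans (hqb t)))
      refine hε _ ⟨h0, hNT t⟩ _ ⟨hm.1, ht.2⟩ ?_
      have := hm.2
      push_cast at this
      linarith
    rw [← intervalIntegral.integral_add_adjacent_intervals (a := 0) (b := N t * δ)
        hqi.intervalIntegrable hqi.intervalIntegrable]
    rw [hx0] at h1
    simp only at h1 ⊢
    linarith

end DiscreteEvolution

/-! ### Measurable choice of subsequences and reverse Fatou -/

section MeasurableSelection

variable {α : Type*} [MeasurableSpace α]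

theorem measurable_eval_nat {β : Type*} [MeasurableSpace β] {u : ℕ → α → β}
    (hu : ∀ n, Measurable (u n)) {N : α → ℕ} (hN : Measurable N) :
    Measurable fun x => u (N x) x :=
  (measurable_from_prod_countable_right (f := fun p : ℕ × α => u p.1 p.2) hu).comp
    (hN.prodMk measurable_id)

/-- A bounded sequence of real measurable functions converges to its upper limit along a pointwise
subsequence that is chosen in a measurable way. -/
theorem exists_measurable_index_tendsto_limsup {h : ℕ → α → ℝ} (hm : ∀ n, Measurable (h n))
    (hb : ∀ x, ∃ B, ∀ n, |h n x| ≤ B) :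
    ∃ N : ℕ → α → ℕ, (∀ k, Measurable (N k)) ∧ (∀ x, Tendsto (fun k => N k x) atTop atTop) ∧
      ∀ x, Tendsto (fun k => h (N k x) x) atTop (𝓝 (limsup (fun n => h n x) atTop)) := by
  classical
  -- Taking the least such n makes the choice measurable, and k ≤ n makes the indices diverge.
  have hfreq : ∀ (k : ℕ) x, ∃ n, k ≤ n ∧
      |h n x - limsup (fun n => h n x) atTop| < 1 / (k + 1 : ℝ) := by
    intro k x
    obtain ⟨B, hB⟩ := hb x
    have hbd : IsBoundedUnder (· ≤ ·) atTop fun n => h n x :=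
      isBoundedUnder_of ⟨B, fun n => (abs_le.1 (hB n)).2⟩
    have hbd' : IsBoundedUnder (· ≥ ·) atTop fun n => h n x :=
      isBoundedUnder_of ⟨-B, fun n => (abs_le.1 (hB n)).1⟩
    have hpos : (0 : ℝ) < 1 / (k + 1 : ℝ) := by positivity
    have h1 : ∃ᶠ n in atTop, limsup (fun n => h n x) atTop - 1 / (k + 1 : ℝ) < h n x :=
      frequently_lt_of_lt_limsup hbd'.isCoboundedUnder_le (by linarith)
    have h2 : ∀ᶠ n in atTop, h n x < limsup (fun n => h n x) atTop + 1 / (k + 1 : ℝ) :=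
      eventually_lt_of_limsup_lt (by linarith) hbd
    obtain ⟨n, hn1, hn2, hn3⟩ := (h1.and_eventually (h2.and (eventually_ge_atTop k))).exists
    exact ⟨n, hn3, abs_lt.2 ⟨by linarith, by linarith⟩⟩
  have hlm : Measurable fun x => limsup (fun n => h n x) atTop := Measurable.limsup hm
  refine ⟨fun k x => Nat.find (hfreq k x), fun k => measurable_find _ fun n => ?_, fun x => ?_,
    fun x => ?_⟩
  · exact (MeasurableSet.const _).inter
      (measurableSet_lt ((hm n).sub hlm).abs measurable_const)
  · exact tendsto_atTop_mono (fun k => (Nat.find_spec (hfreq k x)).1) tendsto_id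
  · rw [tendsto_iff_dist_tendsto_zero]
    refine squeeze_zero (fun _ => dist_nonneg) (fun k => ?_)
      (tendsto_one_div_add_atTop_nhds_zero_nat (𝕜 := ℝ))
    exact (Nat.find_spec (hfreq k x)).2.le

theorem exists_measurable_index_tendsto_finset {ι : Type*} (s : Finset ι) {h : ι → ℕ → α → ℝ}
    (hm : ∀ i n, Measurable (h i n)) (hb : ∀ i x, ∃ B, ∀ n, |h i n x| ≤ B) :
    ∃ N : ℕ → α → ℕ, (∀ k, Measurable (N k)) ∧ (∀ x, Tendsto (fun k => N k x) atTop atTop) ∧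
      ∀ i ∈ s, ∀ x, ∃ l, Tendsto (fun k => h i (N k x) x) atTop (𝓝 l) := by
  classical
  induction s using Finset.induction_on with
  | empty => exact ⟨fun k _ => k, fun k => measurable_const, fun x => tendsto_id, by simp⟩
  | insert a s _ ih =>
    obtain ⟨N, hNm, hNt, hN⟩ := ih
    obtain ⟨M, hMm, hMt, hM⟩ := exists_measurable_index_tendsto_limsup
      (h := fun k x => h a (N k x) x) (fun k => measurable_eval_nat (hm a) (hNm k))
      (fun x => (hb a x).imp fun B hB n => hB _)
    refine ⟨fun k x => N (M k x) x, fun k => measurable_eval_nat hNm (hMm k),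
      fun x => (hNt x).comp (hMt x), fun i hi x => ?_⟩
    rcases Finset.mem_insert.1 hi with rfl | hi
    · exact ⟨_, hM x⟩
    · exact (hN i hi x).imp fun l hl => hl.comp (hMt x)

/-- The Bolzano--Weierstrass theorem with a measurable choice of the subsequence. -/
theorem exists_measurable_index_tendsto {E : Type*} [NormedAddCommGroup E] [InnerProductSpace ℝ E]
    [FiniteDimensional ℝ E] [MeasurableSpace E] [BorelSpace E] {u : ℕ → α → E}
    (hm : ∀ n, Measurable (u n)) (hb : ∀ x, ∃ B, ∀ n, ‖u n x‖ ≤ B) :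
    ∃ (N : ℕ → α → ℕ) (v : α → E), (∀ k, Measurable (N k)) ∧
      (∀ x, Tendsto (fun k => N k x) atTop atTop) ∧ Measurable v ∧
      ∀ x, Tendsto (fun k => u (N k x) x) atTop (𝓝 (v x)) := by
  let b := stdOrthonormalBasis ℝ E
  obtain ⟨N, hNm, hNt, hN⟩ := exists_measurable_index_tendsto_finset Finset.univ
    (h := fun i n x => inner ℝ (b i) (u n x)) (fun i n => measurable_const.inner (hm n))
    (fun i x => (hb x).imp fun B hB n =>
      (abs_real_inner_le_norm _ _).trans (by rw [b.norm_eq_one, one_mul]; exact hB n))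
  choose l hl using fun i => hN i (Finset.mem_univ i)
  have ht : ∀ x, Tendsto (fun k => u (N k x) x) atTop (𝓝 (∑ i, l i x • b i)) := by
    intro x
    have := tendsto_finsetSum Finset.univ fun i _ => (hl i x).smul_const (b i)
    simpa only [b.sum_repr'] using this
  refine ⟨N, fun x => ∑ i, l i x • b i, hNm, hNt, ?_, ht⟩
  exact measurable_of_tendsto_metrizable (fun k => measurable_eval_nat hm (hNm k))
    (tendsto_pi_nhds.2 ht)

/-- A form of the reverse Fatou lemma: if `a` bounds the upper limit of a dominated sequence, then
`∫ a` bounds the upper limit of the integrals. -/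
theorem eventually_integral_le_of_limsup_le {μ : Measure α} {h : ℕ → α → ℝ} {a B : α → ℝ}
    (hm : ∀ n, AEStronglyMeasurable (h n) μ) (hB : Integrable B μ) (hhB : ∀ n x, |h n x| ≤ B x)
    (ha : Integrable a μ) (haB : ∀ x, limsup (fun n => h n x) atTop ≤ a x) {ε : ℝ} (hε : 0 < ε) :
    ∀ᶠ n in atTop, ∫ x, h n x ∂μ ≤ ∫ x, a x ∂μ + ε := by
  have hi : ∀ n, Integrable (h n) μ := fun n => hB.mono' (hm n) (Eventually.of_forall (hhB n))
  -- The sequence itself need not converge, but the positive parts of h n - a tend to 0 and are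
  -- dominated.
  have hlim : Tendsto (fun n => ∫ x, max (h n x - a x) 0 ∂μ) atTop (𝓝 (∫ _, (0 : ℝ) ∂μ)) := by
    refine tendsto_integral_of_dominated_convergence (fun x => B x + |a x|)
      (fun n => (((hi n).sub ha).pos_part).1) (hB.add ha.abs)
      (fun n => Eventually.of_forall fun x => ?_) (Eventually.of_forall fun x => ?_)
    · rw [Real.norm_of_nonneg (le_max_right _ _)]
      refine max_le ?_ ?_
      · linarith [(abs_le.1 (hhB n x)).2, neg_le_abs (a x)]
      · linarith [(abs_nonneg _).trans (hhB n x), abs_nonneg (a x)]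
    · have hbd : IsBoundedUnder (· ≤ ·) atTop fun n => h n x :=
        isBoundedUnder_of ⟨B x, fun n => (abs_le.1 (hhB n x)).2⟩
      rw [Metric.tendsto_nhds]
      intro e he
      filter_upwards [eventually_lt_of_limsup_lt ((haB x).trans_lt (lt_add_of_pos_right _ he)) hbd]
        with n hn
      rw [dist_zero_right, Real.norm_of_nonneg (le_max_right _ _)]
      exact max_lt (by linarith) he
  rw [integral_zero] at hlim
  filter_upwards [hlim.eventually (Iio_mem_nhds hε)] with n hn
  have h1 : ∫ x, (h n x - a x) ∂μ ≤ ∫ x, max (h n x - a x) 0 ∂μ :=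
    integral_mono ((hi n).sub ha) ((hi n).sub ha).pos_part fun x => le_max_left _ _
  rw [integral_sub (hi n) ha] at h1
  have hn : ∫ x, max (h n x - a x) 0 ∂μ < ε := hn
  linarith

end MeasurableSelection

/-! ### Passage to the limit in the time step -/

theorem exists_step_le_intervalIntegral_norm {F : Type*} [NormedAddCommGroup F] {g : ℝ → F}
    (hg : Integrable g) (T : ℝ) {ε : ℝ} (hε : 0 < ε) :
    ∃ δ > 0, ∀ s ∈ Icc 0 T, ∀ t ∈ Icc s T, t - s ≤ δ → ∫ r in s..t, ‖g r‖ ≤ ε := by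
  have hc : ContinuousOn (fun t => ∫ r in (0 : ℝ)..t, ‖g r‖) (Icc 0 T) :=
    (intervalIntegral.continuous_primitive
      (fun _ _ => hg.norm.intervalIntegrable) 0).continuousOn
  obtain ⟨δ, hδ, h⟩ := Metric.uniformContinuousOn_iff.1
    (isCompact_Icc.uniformContinuousOn_of_continuous hc) ε hε
  refine ⟨δ / 2, half_pos hδ, fun s hs t ht hst => ?_⟩
  have h1 := h t ⟨hs.1.trans ht.1, ht.2⟩ s hs (by
    rw [Real.dist_eq, abs_of_nonneg (sub_nonneg.2 ht.1)]; linarith)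
  rw [Real.dist_eq, intervalIntegral.integral_interval_sub_left hg.norm.intervalIntegrable
    hg.norm.intervalIntegrable] at h1
  exact (le_abs_self _).trans h1.le

theorem exists_norm_le_of_tendsto_cobounded {E : Type*} [NormedAddCommGroup E] {S : E → ℝ}
    (hS : Tendsto S (Bornology.cobounded E) atTop) (R : ℝ) : ∃ B, ∀ v, S v ≤ R → ‖v‖ ≤ B := by
  have h1 : Bornology.IsBounded {v | S v ≤ R} := by
    rw [Bornology.isBounded_def]
    filter_upwards [hS.eventually_gt_atTop R] with v hv
    exact not_le.2 hv
  obtain ⟨B, hB⟩ := h1.exists_norm_le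
  exact ⟨B, fun v hv => hB v hv⟩

/-- The orthogonal complement of the range of A is the kernel of the adjoint, which the lower bound
makes trivial. -/
theorem surjective_of_le_norm_adjoint {E F : Type*}
    [NormedAddCommGroup E] [InnerProductSpace ℝ E] [FiniteDimensional ℝ E]
    [NormedAddCommGroup F] [InnerProductSpace ℝ F] [FiniteDimensional ℝ F] {A : E →ₗ[ℝ] F} {γ : ℝ}
    (hγ : 0 < γ) (hA : ∀ q : F, γ * ‖q‖ ≤ ‖LinearMap.adjoint A q‖) : Function.Surjective A := by
  rw [← LinearMap.range_eq_top, ← Submodule.orthogonal_eq_bot_iff, LinearMap.orthogonal_range,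
    LinearMap.ker_eq_bot']
  intro q hq
  have := hA q
  rw [hq, norm_zero] at this
  exact norm_le_zero_iff.1 (nonpos_of_mul_nonpos_right this hγ)

theorem isBoundedMeasurableOn_of_norm_le {X : Type*} [NormedAddCommGroup X] [MeasurableSpace X]
    {T B : ℝ} {v : ℝ → X} (hm : Measurable v) (hB : ∀ t, ‖v t‖ ≤ B) : IsBoundedMeasurableOn T v :=
  ⟨hm.comp measurable_subtype_coe, isBounded_iff_forall_norm_le.2
    ⟨B, by rintro _ ⟨t, -, rfl⟩; exact hB t⟩⟩

theorem liminf_enorm_sub_eq_zero {X : Type*} [NormedAddCommGroup X] {u : ℕ → X} {x : X} {N : ℕ → ℕ}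
    (hN : Tendsto N atTop atTop) (h : Tendsto (fun k => u (N k)) atTop (𝓝 x)) :
    liminf (fun k => ‖u k - x‖ₑ) atTop = 0 := by
  have h1 : Tendsto (fun k => ‖u (N k) - x‖ₑ) atTop (𝓝 0) := by
    simpa using (h.sub_const x).enorm
  refine le_antisymm ?_ bot_le
  rw [← h1.liminf_eq]
  change _ ≤ liminf ((fun k => ‖u k - x‖ₑ) ∘ N) atTop
  rw [liminf_comp]
  exact liminf_le_liminf_of_le hN

theorem theorem2p9
    {E F : Type*}
    [NormedAddCommGroup E] [InnerProductSpace ℝ E] [FiniteDimensional ℝ E]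
    [MeasurableSpace E] [BorelSpace E]
    [NormedAddCommGroup F] [InnerProductSpace ℝ F] [FiniteDimensional ℝ F]
    [MeasurableSpace F] [BorelSpace F]
    (hdim : Module.finrank ℝ F < Module.finrank ℝ E)
    (J : E → ℝ) (hJ : ∀ v, 0 ≤ J v)
    (A : E →ₗ[ℝ] F)
    (hA : ∃ γ : ℝ, 0 < γ ∧ ∀ q : F, γ * ‖q‖ ≤ ‖LinearMap.adjoint A q‖)
    (hJ1 : Tendsto (fun v => J v + ‖A v‖ ^ 2) (Bornology.cobounded E) atTop)
    (η : ℝ) (hη : 0 < η)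
    (hJ2 : ∃ μ : ℝ, 0 < μ ∧ StrongConvexOn Set.univ μ (fun v => J v + η * ‖v‖ ^ 2))
    (hJ3 : ∃ L : ℝ, 0 < L ∧ ∀ v, ∀ ξ ∈ frechetSubdifferential J v, ‖ξ‖ ≤ L * (J v + 1))
    (hJ4 : ∃ C : ℝ, 0 < C ∧ ∀ (w v₁ v₂ : E) (q₁ q₂ : F),
      LinearMap.adjoint A q₁ ∈ frechetSubdifferential (quadPerturbation J η w) v₁ →
      LinearMap.adjoint A q₂ ∈ frechetSubdifferential (quadPerturbation J η w) v₂ →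
      inner ℝ (q₁ - q₂) (A v₁ - A v₂) ≤ C * ‖v₁ - v₂‖ * ‖A v₁ - A v₂‖)
    (T : ℝ) (hT : 0 < T)
    (f f' : ℝ → F) (hf : HasW12Deriv T f f')
    (v₀ : E) (hv₀ : IsConstrainedCriticalPoint A J (f 0) v₀) :
    ∃ (v : ℝ → E) (q : ℝ → F),
      IsBoundedMeasurableOn T v ∧ IsBoundedMeasurableOn T q ∧
      IsApproximableEvolution A J f T v₀ v ∧
      (∀ t ∈ Icc 0 T, LinearMap.adjoint A (q t) ∈ frechetSubdifferential J (v t)) ∧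
      IntegrableOn (fun s => inner ℝ (q s) (f' s)) (Ioo 0 T) ∧
      ∀ t ∈ Icc 0 T, J (v t) ≤ J v₀ + ∫ s in (0 : ℝ)..t, inner ℝ (q s) (f' s) := by
  obtain ⟨γ, hγ, hA⟩ := hA
  obtain ⟨μ, hμ, hJ2⟩ := hJ2
  obtain ⟨L, hL, hJ3⟩ := hJ3
  obtain ⟨C, hC, hJ4⟩ := hJ4
  have hconv : ConvexOn ℝ univ fun v => J v + η * ‖v‖ ^ 2 :=
    (hJ2.strictConvexOn hμ).convexOn
  have hsurj := surjective_of_le_norm_adjoint hγ hA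
  have hJc := continuous_of_convexOn_add_sq hconv
  have hbound : ∀ (w : E) (p : F), LinearMap.adjoint A p ∈ frechetSubdifferential J w →
      ‖p‖ ≤ L / γ * (J w + 1) := fun w p hp => by
    rw [div_mul_eq_mul_div, le_div_iff₀' hγ]
    exact (hA p).trans (hJ3 w _ hp)
  obtain ⟨g, hgm, hg, hfg', hfg⟩ := hf.exists_measurable_deriv hT
  obtain ⟨R, D, hdisc⟩ := exists_discreteEvolution hJ (K := C ^ 2 / (4 * η)) (by positivity)
    (div_nonneg hL.le hγ.le)
    (fun w p c hp => exists_le_of_mem_frechetSubdifferential hJ hsurj hJ1 hη hconv hJ4 hp c)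
    hbound hT hgm hg hfg hv₀
  have hε : ∀ k : ℕ, (0 : ℝ) < 1 / (k + 1) := fun k => by positivity
  choose δ' hδ'0 hδ' using fun k : ℕ => exists_step_le_intervalIntegral_norm hg T (hε k)
  -- The first entry makes ∫‖g‖ over a cell at most 1/(k+1); the second forces δ k → 0.
  set δ : ℕ → ℝ := fun k => min (δ' k) (1 / (k + 1)) with hδdef
  have hδ0 : ∀ k, 0 < δ k := fun k => lt_min (hδ'0 k) (hε k)
  have hδt : Tendsto δ atTop (𝓝 0) := squeeze_zero (fun k => (hδ0 k).le)
    (fun k => min_le_right _ _) (tendsto_one_div_add_atTop_nhds_zero_nat (𝕜 := ℝ))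
  choose w p hwm hpm hw hpw hwR hwf hwE using fun k => hdisc (δ k) (hδ0 k) _ (hε k).le
    fun s hs t ht hst => hδ' k s hs t ht (hst.trans (min_le_left _ _))
  obtain ⟨Bf, hBf⟩ := isCompact_Icc.exists_bound_of_continuousOn hf.continuousOn
  obtain ⟨Bv, hBv⟩ := exists_norm_le_of_tendsto_cobounded hJ1 (R + Bf ^ 2)
  have hwB : ∀ k t, ‖w k t‖ ≤ Bv := fun k t => hBv _ <| by
    obtain ⟨s, hs, hst⟩ := hwf k t
    rw [hst]
    exact add_le_add (hwR k t) (pow_le_pow_left₀ (norm_nonneg _) (hBf s hs) 2)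
  set Bq := L / γ * (R + 1)
  have hpB : ∀ k t, ‖p k t‖ ≤ Bq := fun k t => (hbound _ _ (hpw k t)).trans
    (mul_le_mul_of_nonneg_left (by linarith [hwR k t]) (div_nonneg hL.le hγ.le))
  set θ : ℕ → ℝ → ℝ := fun k s => inner ℝ (p k s) (g s)
  have hθm : ∀ k, Measurable (θ k) := fun k => (hpm k).inner hgm
  have hθB : ∀ k s, |θ k s| ≤ Bq * ‖g s‖ := fun k s => (abs_real_inner_le_norm _ _).trans
    (mul_le_mul_of_nonneg_right (hpB k s) (norm_nonneg _))
  -- The power is extracted first: later refinements keep its limit, which identifies ⟨q, g⟩ with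
  -- the upper limit of the full sequence.
  obtain ⟨N₁, hN₁m, hN₁t, hN₁⟩ := exists_measurable_index_tendsto_limsup hθm
    fun s => ⟨_, fun k => hθB k s⟩
  obtain ⟨N₂, v, hN₂m, hN₂t, hvm, hv⟩ := exists_measurable_index_tendsto
    (u := fun k t => w (N₁ k t) t) (fun k => measurable_eval_nat hwm (hN₁m k))
    fun t => ⟨_, fun k => hwB _ t⟩
  obtain ⟨N₃, q, hN₃m, hN₃t, hqm, hq⟩ := exists_measurable_index_tendsto
    (u := fun k t => p (N₁ (N₂ k t) t) t)
    (fun k => measurable_eval_nat hpm (measurable_eval_nat hN₁m (hN₂m k)))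
    fun t => ⟨_, fun k => hpB _ t⟩
  set N : ℕ → ℝ → ℕ := fun k t => N₁ (N₂ (N₃ k t) t) t
  have hNt : ∀ t, Tendsto (fun k => N k t) atTop atTop := fun t =>
    (hN₁t t).comp ((hN₂t t).comp (hN₃t t))
  have hwN : ∀ t, Tendsto (fun k => w (N k t) t) atTop (𝓝 (v t)) := fun t =>
    (hv t).comp (hN₃t t)
  have hpN : ∀ t, Tendsto (fun k => p (N k t) t) atTop (𝓝 (q t)) := hq
  have hqθ : ∀ s, inner ℝ (q s) (g s) = limsup (fun k => θ k s) atTop := fun s =>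
    tendsto_nhds_unique ((hpN s).inner tendsto_const_nhds)
      ((hN₁ s).comp ((hN₂t s).comp (hN₃t s)))
  have hvB : ∀ t, ‖v t‖ ≤ Bv := fun t => le_of_tendsto' (hwN t).norm fun k => hwB _ t
  have hqB : ∀ t, ‖q t‖ ≤ Bq := fun t => le_of_tendsto' (hpN t).norm fun k => hpB _ t
  have hqg : Integrable fun s => (inner ℝ (q s) (g s) : ℝ) :=
    (hg.norm.const_mul Bq).mono' (hqm.inner hgm).aestronglyMeasurable
      (Eventually.of_forall fun s => (norm_inner_le_norm _ _).trans
        (mul_le_mul_of_nonneg_right (hqB s) (norm_nonneg _)))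
  have hae : (fun s => (inner ℝ (q s) (g s) : ℝ)) =ᵐ[volume.restrict (Ioo 0 T)]
      fun s => inner ℝ (q s) (f' s) := hfg'.mono fun s hs => by simp only [hs]
  have hvb := isBoundedMeasurableOn_of_norm_le (T := T) hvm hvB
  refine ⟨v, q, hvb, isBoundedMeasurableOn_of_norm_le hqm hqB,
    ⟨hvb, δ, w, hδ0, hδt, hw, fun t _ => liminf_enorm_sub_eq_zero (hNt t) (hwN t)⟩,
    fun t _ => ?_, hqg.integrableOn.congr hae, fun t ht => ?_⟩
  · exact mem_frechetSubdifferential_of_tendsto hη hconv (hwN t)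
      (((LinearMap.continuous_of_finiteDimensional (LinearMap.adjoint A)).tendsto _).comp (hpN t))
      fun k => hpw _ t
  · have hint : ∫ s in (0 : ℝ)..t, inner ℝ (q s) (f' s) = ∫ s in Ioc 0 t, inner ℝ (q s) (g s) := by
      rw [intervalIntegral.integral_of_le ht.1, integral_Ioc_eq_integral_Ioo,
        integral_Ioc_eq_integral_Ioo]
      exact (integral_congr_ae (ae_restrict_of_ae_restrict_of_subset
        (Ioo_subset_Ioo_right ht.2) hae)).symm
    rw [hint]
    refine le_of_forall_pos_le_add fun e he => ?_
    -- This holds along the full sequence, hence at the indices N k t, fixed while s varies; the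
    -- subsequences chosen at other times s play no role.
    have h1 : ∀ᶠ k in atTop, ∫ s in Ioc 0 t, θ k s ≤
        (∫ s in Ioc 0 t, inner ℝ (q s) (g s)) + e / 2 :=
      eventually_integral_le_of_limsup_le (fun k => (hθm k).aestronglyMeasurable)
        (hg.norm.const_mul Bq).integrableOn hθB hqg.integrableOn (fun s => (hqθ s).ge) (half_pos he)
    have h2 : ∀ᶠ k : ℕ in atTop, D * (1 / (k + 1 : ℝ)) < e / 2 := by
      have := (tendsto_one_div_add_atTop_nhds_zero_nat (𝕜 := ℝ)).const_mul D
      rw [mul_zero] at this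
      exact this.eventually (Iio_mem_nhds (half_pos he))
    refine le_of_tendsto ((hJc.tendsto _).comp (hwN t)) ?_
    filter_upwards [(hNt t).eventually (h1.and h2)] with k hk
    have h3 := hwE (N k t) t ht
    rw [intervalIntegral.integral_of_le ht.1] at h3
    simp only [Function.comp_apply]
    linarith [hk.1, hk.2]
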